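/- Let $R$ be a commutative artinian ring and let $\Lambda,\Gamma$ be artin $R$-algebras, i.e. $R$-algebras that are finitely generated as $R$-modules. Let $\Gamma$ be a split-by-nilpotent extension of $\Lambda$ by a two-sided ideal $I$ of $\Gamma$: there are homomorphisms of $R$-algebras $\pi:\Gamma\to\Lambda$, surjective with kernel $I$, and $\sigma:\Lambda\to\Gamma$ with $\pi\sigma=1_\Lambda$, and $I\subseteq\mathrm{rad}(\Gamma)$. Through $\sigma$, regard $\Gamma$ as a $\Gamma$-$\Lambda$-bimodule and $I$ as a $\Lambda$-$\Lambda$-bimodule, and put $G:=\Gamma\otimes_\Lambda-:\mathrm{mod}(\Lambda)\to\mathrm{mod}(\Gamma)$, where $\mathrm{mod}$ denotes finitely generated left modules. For a finite set $[1,t]$ with a linear order $\le$ (any linear order) and an artin algebra $A$: * A stratifying system $(\Theta,\le)$ of size $t$ in $\mathrm{mod}(A)$ is a family $\Theta=\{\Theta(i)\}_{i=1}^t$ of indecomposable modules in $\mathrm{mod}(A)$ with $\mathrm{Hom}_A(\Theta(i),\Theta(j))=0$ for $i>j$ and $\mathrm{Ext}^1_A(\Theta(i),\Theta(j))=0$ for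 $i\ge j$. * An Ext-projective stratifying system $(\Theta,\underline Q,\le)$ of size $t$ in $\mathrm{mod}(A)$ consists of families of non-zero modules $\Theta=\{\Theta(i)\}_{i=1}^t$ and $\underline Q=\{Q(i)\}_{i=1}^t$ in $\mathrm{mod}(A)$, with every $Q(i)$ indecomposable, such that (a) $\mathrm{Hom}_A(\Theta(i),\Theta(j))=0$ for $i>j$; (b) for each $i$ there is an exact sequence $0\to K(i)\to Q(i)\to\Theta(i)\to0$ in which $K(i)$ has a finite filtration $0=M_0\subseteq M_1\subseteq\cdots\subseteq M_s=K(i)$ by submodules with every factor $M_{k+1}/M_k$ isomorphic to some $\Theta(j)$ with $j>i$; (c) $\mathrm{Ext}^1_A(Q,\mathbf\Theta)=0$, where $Q:=\bigoplus_{i=1}^tQ(i)$ and $\mathbf\Theta:=\bigoplus_{i=1}^t\Theta(i)$. If moreover $(\Theta,\le)$ is a stratifying system, then $(\Theta,\underline Q,\le)$ is called the Ext-projective stratifying system associated to $(\Theta,\le)$. Assume that $I$ is projective as a right $\Lambda$-module. Let $(\Theta,\le)$ be a stratifying system of size $t$ in $\mathrm{mod}(\Lambda)$ which is compatible with $I$,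 i.e. $\mathrm{Hom}_\Lambda(\Theta(j),I\otimes_\Lambda\Theta(i))=0$ for $j>i$ and $\mathrm{Ext}^1_\Lambda(\Theta(j),I\otimes_\Lambda\Theta(i))=0$ for $j\ge i$, and let $(\Theta,\underline Q,\le)$ be the Ext-projective stratifying system associated to $(\Theta,\le)$. Then $(G\Theta,\le):=(\{G(\Theta(i))\}_{i=1}^t,\le)$ is a stratifying system in $\mathrm{mod}(\Gamma)$, and $$\mathrm{Ext}^1_\Lambda(Q,I\otimes_\Lambda\mathbf\Theta)=0$$ if and only if $(G\Theta,G\underline Q,\le)$, with $G\underline Q:=\{G(Q(i))\}_{i=1}^t$, is the Ext-projective stratifying system associated to $(G\Theta,\le)$. -/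

import Mathlib

open CategoryTheory CategoryTheory.Limits
open scoped TensorProduct DirectSum

universe u

/-! ### Tensor product of a bimodule with a left module over a noncommutative ring -/

/-- For an `S`-`A`-bimodule `N` and a left `A`-module `M`: the `S`-submodule of `N ⊗[ℤ] M` generated
by the elements `n a ⊗ m - n ⊗ a m`. As this set is stable under the left action of `S`, it is
also the additive subgroup generated by these elements. -/
def bimodTensorRel (S A N M : Type*) [Ring S] [Ring A] [AddCommGroup N] [Module S N]
    [Module Aᵐᵒᵖ N] [SMulCommClass S Aᵐᵒᵖ N] [AddCommGroup M] [Module A M] :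
    Submodule S (N ⊗[ℤ] M) :=
  Submodule.span S
    {x | ∃ (n : N) (a : A) (m : M), x = (MulOpposite.op a • n) ⊗ₜ[ℤ] m - n ⊗ₜ[ℤ] (a • m)}

/-- The left `S`-module `N ⊗_A M`, for an `S`-`A`-bimodule `N` and a left `A`-module `M`. -/
abbrev BimodTensor (S A N M : Type*) [Ring S] [Ring A] [AddCommGroup N] [Module S N]
    [Module Aᵐᵒᵖ N] [SMulCommClass S Aᵐᵒᵖ N] [AddCommGroup M] [Module A M] : Type _ :=
  (N ⊗[ℤ] M) ⧸ bimodTensorRel S A N M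

/-! ### Stratifying systems -/

section Stratifying

variable {Λ : Type u} [Ring Λ]

/-- `Ext¹_Λ(X, Y) = 0`. -/
def ExtOneVanishes (X Y : ModuleCat.{u} Λ) : Prop :=
  Subsingleton (Abelian.Ext.{u} X Y 1)

/-- The direct sum of a family of `Λ`-modules. -/
noncomputable abbrev sumModule {ι : Type} (X : ι → ModuleCat.{u} Λ) : ModuleCat.{u} Λ :=
  ModuleCat.of Λ (⨁ i, X i)

/-- `M` belongs to `𝔉(C)`: there is a chain of submodules `0 = M₀ ⊆ M₁ ⊆ ⋯ ⊆ Mₛ = M` such that each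
factor `Mₖ₊₁ / Mₖ` is isomorphic to a module in the set `C`. -/
def IsFilteredBy (C : Set (ModuleCat.{u} Λ)) (M : ModuleCat.{u} Λ) : Prop :=
  ∃ (s : ℕ) (F : ℕ → Submodule Λ M), F 0 = ⊥ ∧ F s = ⊤ ∧
    ∀ k < s, F k ≤ F (k + 1) ∧
      ∃ X ∈ C, Nonempty ((↥(F (k + 1)) ⧸ (F k).submoduleOf (F (k + 1))) ≃ₗ[Λ] X)

/-- `(Θ, ≤)` is a stratifying system in `mod(Λ)`; its size is the cardinality of the finite linearly
ordered index set `ι`. -/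
structure IsStratifyingSystem {ι : Type} [Fintype ι] [LinearOrder ι]
    (Θ : ι → ModuleCat.{u} Λ) : Prop where
  finite : ∀ i, Module.Finite Λ (Θ i)
  indecomposable : ∀ i, Indecomposable (Θ i)
  hom_eq_zero : ∀ i j, j < i → ∀ f : Θ i →ₗ[Λ] Θ j, f = 0
  ext_eq_zero : ∀ i j, j ≤ i → ExtOneVanishes (Θ i) (Θ j)

/-- `(Θ, Q, ≤)` is an Ext-projective stratifying system in `mod(Λ)`. -/
structure IsExtProjStratifyingSystem {ι : Type} [Fintype ι] [LinearOrder ι]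
    (Θ Q : ι → ModuleCat.{u} Λ) : Prop where
  finite_left : ∀ i, Module.Finite Λ (Θ i)
  finite_right : ∀ i, Module.Finite Λ (Q i)
  nontrivial_left : ∀ i, Nontrivial (Θ i)
  indecomposable : ∀ i, Indecomposable (Q i)
  hom_eq_zero : ∀ i j, j < i → ∀ f : Θ i →ₗ[Λ] Θ j, f = 0
  exact_seq : ∀ i, ∃ (K : ModuleCat.{u} Λ) (α : K →ₗ[Λ] Q i) (β : Q i →ₗ[Λ] Θ i),
    Function.Injective α ∧ Function.Exact α β ∧ Function.Surjective β ∧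
      IsFilteredBy {X | ∃ j, i < j ∧ X = Θ j} K
  ext_eq_zero : ExtOneVanishes (sumModule Q) (sumModule Θ)

/-- `(Θ, Q, ≤)` is the Ext-projective stratifying system associated to the stratifying system
`(Θ, ≤)`. -/
def IsAssociatedExtProj {ι : Type} [Fintype ι] [LinearOrder ι]
    (Θ Q : ι → ModuleCat.{u} Λ) : Prop :=
  IsStratifyingSystem Θ ∧ IsExtProjStratifyingSystem Θ Q

end Stratifying

/-! ### Split-by-nilpotent extensions -/

/-- The data exhibiting the `R`-algebra `Γ` as a split-by-nilpotent extension of the `R`-algebra `Λ`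
by the two-sided ideal `I` of `Γ`. -/
structure SplitByNilpotentExt (R : Type*) (Λ Γ : Type u) [CommRing R] [Ring Λ] [Ring Γ]
    [Algebra R Λ] [Algebra R Γ] (I : TwoSidedIdeal Γ) where
  /-- The projection `π`. -/
  proj : Γ →ₐ[R] Λ
  /-- The section `σ`. -/
  sec : Λ →ₐ[R] Γ
  proj_surjective : Function.Surjective proj
  mem_iff : ∀ x, x ∈ I ↔ proj x = 0
  proj_sec : ∀ x, proj (sec x) = x
  mem_jacobson : ∀ x ∈ I, x ∈ Ring.jacobson Γ

namespace SplitByNilpotentExt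

variable {R : Type*} {Λ Γ : Type u} [CommRing R] [Ring Λ] [Ring Γ]
  [Algebra R Λ] [Algebra R Γ] {I : TwoSidedIdeal Γ}

/-- `Γ` as a `Γ`-`Λ`-bimodule, the right action of `Λ` being that through `σ`. -/
def GammaBimod (_E : SplitByNilpotentExt R Λ Γ I) : Type u := Γ

/-- `I` as a `Λ`-`Λ`-bimodule, both actions being through `σ`. -/
def IdealBimod (_E : SplitByNilpotentExt R Λ Γ I) : Type u := I

variable (E : SplitByNilpotentExt R Λ Γ I)

noncomputable instance : AddCommGroup E.GammaBimod := inferInstanceAs (AddCommGroup Γ)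

noncomputable instance : Module Γ E.GammaBimod := inferInstanceAs (Module Γ Γ)

noncomputable instance : Module Λᵐᵒᵖ E.GammaBimod :=
  Module.compHom Γ (RingHom.op (E.sec : Λ →+* Γ))

instance : SMulCommClass Γ Λᵐᵒᵖ E.GammaBimod :=
  ⟨fun g a x => (mul_assoc (g : Γ) (x : Γ) (E.sec a.unop)).symm⟩

noncomputable instance : AddCommGroup E.IdealBimod := inferInstanceAs (AddCommGroup I)

noncomputable instance : Module Λ E.IdealBimod := Module.compHom I (E.sec : Λ →+* Γ)

noncomputable instance : Module Λᵐᵒᵖ E.IdealBimod :=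
  Module.compHom I (RingHom.op (E.sec : Λ →+* Γ))

instance : SMulCommClass Λ Λᵐᵒᵖ E.IdealBimod :=
  ⟨fun b a x => Subtype.ext (mul_assoc (E.sec b) (x : I).1 (E.sec a.unop)).symm⟩

/-- The change of rings functor `G = Γ ⊗_Λ -` on objects. -/
noncomputable def G (M : ModuleCat.{u} Λ) : ModuleCat.{u} Γ :=
  ModuleCat.of Γ (BimodTensor Γ Λ E.GammaBimod M)

/-- The left `Λ`-module `I ⊗_Λ M`. -/
noncomputable def idealTensor (M : ModuleCat.{u} Λ) : ModuleCat.{u} Λ :=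
  ModuleCat.of Λ (BimodTensor Λ Λ E.IdealBimod M)

/-- The compatibility of `(Θ, ≤)` with the ideal `I`. -/
structure Compatible {ι : Type} [Fintype ι] [LinearOrder ι] (Θ : ι → ModuleCat.{u} Λ) :
    Prop where
  hom_eq_zero : ∀ i j, i < j → ∀ f : Θ j →ₗ[Λ] E.idealTensor (Θ i), f = 0
  ext_eq_zero : ∀ i j, i ≤ j → ExtOneVanishes (Θ j) (E.idealTensor (Θ i))

end SplitByNilpotentExt

/-! ### Criteria for vanishing of Ext¹ and for indecomposability. -/

section Modules

variable {A : Type u} [Ring A]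

/-! Since `Γ = σ(Λ) ⊕ I`, the restriction of `G N` to `Λ` is `N × (I ⊗ N)` (`resGEquiv`), and `G` is
left adjoint to restriction along `σ`. As `I` is right projective, `G` is exact; it also preserves
projectives, so extension problems transpose: `Ext¹(G M, Y)` vanishes iff `Ext¹(M, res Y)` does.
Hence `Ext¹(G M, G N) = 0` iff `Ext¹(M, N) = 0` and `Ext¹(M, I ⊗ N) = 0` (`extOneVanishes_G_G_iff`);
`G_hom_eq_zero` is the analogue for Hom. Compatibility supplies exactly the conditions on `I ⊗
Θ(i)`.

Indecomposability survives because an idempotent of `G M` reduces modulo `I` to one of `M`, and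
Nakayama's lemma shows that an idempotent reducing to zero is zero (`indecomposable_G`). Exactness
carries over the sequences and filtrations of condition (b). Only condition (c) is left, and as
`Ext¹(Q, Θ) = 0` is already known, it amounts to `Ext¹(Q, I ⊗ Θ) = 0`. -/

/-- `Ext¹(X, Y)` vanishes iff every map `K → Y` extends to `P`, for a given exact sequence
`0 → K → P → X → 0` with `P` projective. -/
theorem extOneVanishes_iff_of_projective {X Y : ModuleCat.{u} A} {K P : Type u}
    [AddCommGroup K] [Module A K] [AddCommGroup P] [Module A P] [Module.Projective A P]
    (i : K →ₗ[A] P) (p : P →ₗ[A] X) (hi : Function.Injective i) (hip : Function.Exact i p)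
    (hp : Function.Surjective p) :
    ExtOneVanishes X Y ↔ ∀ f : K →ₗ[A] Y, ∃ g : P →ₗ[A] Y, g ∘ₗ i = f := by
  let S : ShortComplex (ModuleCat.{u} A) :=
    ShortComplex.mk (ModuleCat.ofHom i) (ModuleCat.ofHom p) (by
      ext x; exact hip.apply_apply_eq_zero x)
  have hS : S.ShortExact :=
    { exact := (ShortComplex.ShortExact.moduleCat_exact_iff_function_exact _).mpr hip
      mono_f := (ModuleCat.mono_iff_injective _).mpr hi
      epi_g := (ModuleCat.epi_iff_surjective _).mpr hp }
  have : Projective S.X₂ := ModuleCat.projective_of_categoryTheory_projective (ModuleCat.of A P)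
  constructor
  · intro h f
    have h' : Subsingleton (Abelian.Ext.{u} S.X₃ Y 1) := h
    obtain ⟨x, hx⟩ := Abelian.Ext.contravariant_sequence_exact₁ hS Y
      (Abelian.Ext.mk₀ (ModuleCat.ofHom f : S.X₁ ⟶ Y)) (add_zero 1) (Subsingleton.elim _ _)
    obtain ⟨g, rfl⟩ := Abelian.Ext.addEquiv₀.symm.surjective x
    have hg : S.f ≫ g = ModuleCat.ofHom f := by
      apply Abelian.Ext.addEquiv₀.symm.injective
      simpa using hx
    exact ⟨g.hom, congrArg ModuleCat.Hom.hom hg⟩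
  · intro h
    refine subsingleton_of_forall_eq 0 fun (x : Abelian.Ext.{u} S.X₃ Y 1) => ?_
    -- `Ext¹(P, Y) = 0`, so `x` is the class of the sequence composed with a map `K → Y`. That map
    -- factors through `K → P`, which annihilates the class.
    obtain ⟨y, rfl⟩ := Abelian.Ext.contravariant_sequence_exact₃ hS Y x
      (Abelian.Ext.eq_zero_of_projective _) (add_zero 1)
    obtain ⟨f, rfl⟩ := Abelian.Ext.addEquiv₀.symm.surjective y
    obtain ⟨g, hg⟩ := h f.hom
    have hg' : f = S.f ≫ ModuleCat.ofHom g := by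
      ext x; exact (LinearMap.congr_fun hg x).symm
    subst hg'
    rw [Abelian.Ext.addEquiv₀_symm_apply, ← Abelian.Ext.mk₀_comp_mk₀]
    exact hS.extClass_comp_assoc _

theorem exists_projective_presentation (X : Type u) [AddCommGroup X] [Module A X] :
    ∃ (K P : ModuleCat.{u} A) (i : K →ₗ[A] P) (p : P →ₗ[A] X), Module.Projective A P ∧
      Function.Injective i ∧ Function.Exact i p ∧ Function.Surjective p :=
  ⟨ModuleCat.of A (LinearMap.ker (Finsupp.linearCombination A (id : X → X))),
    ModuleCat.of A (X →₀ A), Submodule.subtype _, Finsupp.linearCombination A id,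
    inferInstanceAs (Module.Projective A (X →₀ A)), Submodule.injective_subtype _,
    LinearMap.exact_subtype_ker_map _, Finsupp.linearCombination_id_surjective A X⟩

theorem extOneVanishes_congr_left {X X' Y : ModuleCat.{u} A} (e : X ≃ₗ[A] X') :
    ExtOneVanishes X Y ↔ ExtOneVanishes X' Y := by
  obtain ⟨K, P, i, p, hP, hi, hip, hp⟩ := exists_projective_presentation (A := A) X
  rw [extOneVanishes_iff_of_projective i p hi hip hp,
    extOneVanishes_iff_of_projective (X := X') i (e.toLinearMap ∘ₗ p) hi
      (fun x => by simpa using hip x) (e.surjective.comp hp)]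

theorem extOneVanishes_congr_right {X Y Y' : ModuleCat.{u} A} (e : Y ≃ₗ[A] Y') :
    ExtOneVanishes X Y ↔ ExtOneVanishes X Y' := by
  obtain ⟨K, P, i, p, hP, hi, hip, hp⟩ := exists_projective_presentation (A := A) X
  rw [extOneVanishes_iff_of_projective i p hi hip hp,
    extOneVanishes_iff_of_projective i p hi hip hp]
  constructor
  · intro h f
    obtain ⟨g, hg⟩ := h (e.symm.toLinearMap ∘ₗ f)
    exact ⟨e.toLinearMap ∘ₗ g, by rw [LinearMap.comp_assoc, hg]; ext; simp⟩
  · intro h f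
    obtain ⟨g, hg⟩ := h (e.toLinearMap ∘ₗ f)
    exact ⟨e.symm.toLinearMap ∘ₗ g, by rw [LinearMap.comp_assoc, hg]; ext; simp⟩

theorem extOneVanishes_prod_iff {X Y Z : ModuleCat.{u} A} :
    ExtOneVanishes X (ModuleCat.of A (Y × Z)) ↔ ExtOneVanishes X Y ∧ ExtOneVanishes X Z := by
  obtain ⟨K, P, i, p, hP, hi, hip, hp⟩ := exists_projective_presentation (A := A) X
  simp only [extOneVanishes_iff_of_projective i p hi hip hp]
  constructor
  · refine fun h => ⟨fun f => ?_, fun f => ?_⟩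
    · obtain ⟨g, hg⟩ := h (LinearMap.inl A Y Z ∘ₗ f)
      exact ⟨LinearMap.fst A Y Z ∘ₗ g, by rw [LinearMap.comp_assoc, hg]; rfl⟩
    · obtain ⟨g, hg⟩ := h (LinearMap.inr A Y Z ∘ₗ f)
      exact ⟨LinearMap.snd A Y Z ∘ₗ g, by rw [LinearMap.comp_assoc, hg]; rfl⟩
  · rintro ⟨h₁, h₂⟩ f
    obtain ⟨g₁, hg₁⟩ := h₁ (LinearMap.fst A Y Z ∘ₗ f)
    obtain ⟨g₂, hg₂⟩ := h₂ (LinearMap.snd A Y Z ∘ₗ f)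
    exact ⟨g₁.prod g₂, LinearMap.ext fun x =>
      Prod.ext (LinearMap.congr_fun hg₁ x) (LinearMap.congr_fun hg₂ x)⟩

/-- Idempotents correspond to decompositions `M = ker e ⊕ range e`; in this form indecomposability
can be compared along `G`. -/
theorem indecomposable_iff_idempotents (M : ModuleCat.{u} A) :
    Indecomposable M ↔ Nontrivial M ∧
      ∀ e : M →ₗ[A] M, e ∘ₗ e = e → e = 0 ∨ e = LinearMap.id := by
  unfold Indecomposable
  rw [ModuleCat.isZero_iff_subsingleton, not_subsingleton_iff_nontrivial]
  refine and_congr_right fun _ => ⟨fun h e he => ?_, fun h Y Z φ => ?_⟩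
  · have hc : IsCompl (LinearMap.ker e) (LinearMap.range e) :=
      (LinearMap.IsIdempotentElem.isCompl (f := e) he).symm
    have φ : M ≅ ModuleCat.of A (LinearMap.ker e) ⊞ ModuleCat.of A (LinearMap.range e) :=
      (Submodule.prodEquivOfIsCompl _ _ hc).symm.toModuleIso ≪≫
        (ModuleCat.biprodIsoProd (ModuleCat.of A (LinearMap.ker e))
          (ModuleCat.of A (LinearMap.range e))).symm
    rcases h _ _ φ with h | h
    · right
      rw [ModuleCat.isZero_of_iff_subsingleton, Submodule.subsingleton_iff_eq_bot,
        LinearMap.ker_eq_bot] at h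
      exact LinearMap.ext fun x => h (LinearMap.congr_fun he x)
    · left
      rw [ModuleCat.isZero_of_iff_subsingleton, Submodule.subsingleton_iff_eq_bot,
        LinearMap.range_eq_bot] at h
      exact h
  · let ψ : M ≃ₗ[A] (Y × Z) := (φ ≪≫ ModuleCat.biprodIsoProd Y Z).toLinearEquiv
    rw [ModuleCat.isZero_iff_subsingleton, ModuleCat.isZero_iff_subsingleton]
    let e : M →ₗ[A] M := ψ.symm.toLinearMap ∘ₗ LinearMap.inl A Y Z ∘ₗ LinearMap.fst A Y Z ∘ₗ
      ψ.toLinearMap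
    have he : ∀ x, ψ (e x) = ((ψ x).1, 0) := fun x => by simp [e]
    rcases h e (LinearMap.ext fun x => ψ.injective (by simp [he])) with h | h
    · refine Or.inl (subsingleton_of_forall_eq 0 fun y => ?_)
      have := he (ψ.symm (y, 0))
      rw [h] at this
      simpa using (congrArg Prod.fst this).symm
    · refine Or.inr (subsingleton_of_forall_eq 0 fun z => ?_)
      have := he (ψ.symm (0, z))
      rw [h] at this
      simpa using congrArg Prod.snd this

end Modules

/-! ### Tensor products over a noncommutative ring, and flatness of projectives. -/

namespace BimodTensor

variable {S A N M M' : Type*} [Ring S] [Ring A] [AddCommGroup N] [Module S N]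
  [Module Aᵐᵒᵖ N] [SMulCommClass S Aᵐᵒᵖ N] [AddCommGroup M] [Module A M]
  [AddCommGroup M'] [Module A M']

/-- The element `n ⊗ m` of `N ⊗_A M`. -/
def mk (S : Type*) {A N M : Type*} [Ring S] [Ring A] [AddCommGroup N] [Module S N]
    [Module Aᵐᵒᵖ N] [SMulCommClass S Aᵐᵒᵖ N] [AddCommGroup M] [Module A M] (n : N) (m : M) :
    BimodTensor S A N M :=
  Submodule.Quotient.mk (n ⊗ₜ[ℤ] m)

theorem mk_op_smul (a : A) (n : N) (m : M) :
    (mk S (MulOpposite.op a • n) m : BimodTensor S A N M) = mk S n (a • m) :=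
  (Submodule.Quotient.eq _).mpr (Submodule.subset_span ⟨n, a, m, rfl⟩)

theorem smul_mk (s : S) (n : N) (m : M) :
    s • (mk S n m : BimodTensor S A N M) = mk S (s • n) m := rfl

theorem mk_add_left (n n' : N) (m : M) :
    (mk S (n + n') m : BimodTensor S A N M) = mk S n m + mk S n' m :=
  congrArg Submodule.Quotient.mk (TensorProduct.add_tmul n n' m)

theorem mk_add_right (n : N) (m m' : M) :
    (mk S n (m + m') : BimodTensor S A N M) = mk S n m + mk S n m' :=
  congrArg Submodule.Quotient.mk (TensorProduct.tmul_add n m m')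

variable (S A N M) in
/-- `mk` as a biadditive map. -/
def mkHom : N →+ M →+ BimodTensor S A N M :=
  AddMonoidHom.mk' (fun n => AddMonoidHom.mk' (mk S n) (mk_add_right n))
    fun n n' => by ext m; exact mk_add_left n n' m

@[simp]
theorem mkHom_apply (n : N) (m : M) : mkHom S A N M n m = mk S n m := rfl

theorem mk_zero_left (m : M) : (mk S 0 m : BimodTensor S A N M) = 0 := by
  rw [← mkHom_apply, map_zero, AddMonoidHom.zero_apply]

@[elab_as_elim]
theorem induction {motive : BimodTensor S A N M → Prop} (x : BimodTensor S A N M)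
    (zero : motive 0) (mk : ∀ n m, motive (mk S n m))
    (add : ∀ x y, motive x → motive y → motive (x + y)) : motive x := by
  obtain ⟨x, rfl⟩ := Submodule.Quotient.mk_surjective _ x
  induction x using TensorProduct.induction_on with
  | zero => exact zero
  | tmul n m => exact mk n m
  | add x y hx hy => exact add _ _ hx hy

/-- The additive map out of `N ⊗_A M` given by a balanced biadditive map. -/
def lift {T : Type*} [AddCommGroup T] (φ : N →+ M →+ T)
    (h : ∀ n (a : A) m, φ (MulOpposite.op a • n) m = φ n (a • m)) : BimodTensor S A N M →+ T :=
  QuotientAddGroup.lift _ (TensorProduct.liftAddHom (R := ℤ) φ fun r n m => by simp) (by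
    intro x hx
    replace hx : x ∈ bimodTensorRel S A N M := hx
    -- The relations are an `S`-span while `φ` is only additive, so the induction must carry all
    -- multiples `s • x`.
    suffices H : ∀ s : S, TensorProduct.liftAddHom (R := ℤ) φ (fun r n m => by simp) (s • x) = 0 by
      simpa using H 1
    induction hx using Submodule.span_induction with
    | mem x hx =>
      obtain ⟨n, a, m, rfl⟩ := hx
      intro s
      rw [smul_sub, TensorProduct.smul_tmul', TensorProduct.smul_tmul', smul_comm s, map_sub,
        TensorProduct.liftAddHom_tmul, TensorProduct.liftAddHom_tmul, h, sub_self]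
    | zero => simp
    | add x y _ _ hx hy => intro s; rw [smul_add, map_add, hx, hy, add_zero]
    | smul r x _ hx => intro s; rw [smul_smul, hx])

@[simp]
theorem lift_mk {T : Type*} [AddCommGroup T] (φ : N →+ M →+ T)
    (h : ∀ n (a : A) m, φ (MulOpposite.op a • n) m = φ n (a • m)) (n : N) (m : M) :
    lift φ h (mk S n m : BimodTensor S A N M) = φ n m := rfl

/-- An additive map out of `N ⊗_A M` which is linear on the elements `n ⊗ m` is linear. -/
def linearMapOfAddHom {S' T : Type*} [Ring S'] [AddCommGroup T] [Module S' T] {ρ : S →+* S'}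
    (f : BimodTensor S A N M →+ T)
    (h : ∀ (s : S) n m, f (mk S (s • n) m) = ρ s • f (mk S n m)) :
    BimodTensor S A N M →ₛₗ[ρ] T where
  toFun := f
  map_add' := map_add f
  map_smul' s x := by
    induction x using BimodTensor.induction with
    | zero => simp
    | mk n m => exact h s n m
    | add x y hx hy => rw [smul_add, map_add, hx, hy, map_add, smul_add]

variable (S N) in
/-- The map `N ⊗_A f`. -/
def map (f : M →ₗ[A] M') : BimodTensor S A N M →ₗ[S] BimodTensor S A N M' :=
  linearMapOfAddHom (ρ := RingHom.id S)
    (lift ((AddMonoidHom.compHom' f.toAddMonoidHom).comp (mkHom S A N M'))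
      fun n a m => by simp [mk_op_smul])
    fun s n m => rfl

@[simp]
theorem map_mk (f : M →ₗ[A] M') (n : N) (m : M) : map S N f (mk S n m) = mk S n (f m) := rfl

/-- The additive map `n ⊗ m ↦ s(n) m` for a right linear form `s` on `N`. -/
def contract (s : N →ₗ[Aᵐᵒᵖ] Aᵐᵒᵖ) : BimodTensor S A N M →+ M :=
  lift (AddMonoidHom.mk' (fun n => AddMonoidHom.mk' (fun m => (s n).unop • m)
    (fun m m' => smul_add _ m m')) fun n n' => by ext m; simp [add_smul])
    fun n a m => by simp [mul_smul]

@[simp]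
theorem contract_mk (s : N →ₗ[Aᵐᵒᵖ] Aᵐᵒᵖ) (n : N) (m : M) :
    contract s (mk S n m : BimodTensor S A N M) = (s n).unop • m := rfl

/-- Tensoring with a projective right module preserves injectivity. -/
theorem map_injective [hN : Module.Projective Aᵐᵒᵖ N] (f : M →ₗ[A] M')
    (hf : Function.Injective f) : Function.Injective (map S N f) := by
  -- A splitting of the free cover on the set `N` is a dual basis: `n` is the sum of the `x ·
  -- s(n)(x)`. Its coordinate forms give maps `ψ x` to `M`, natural in `M`.
  obtain ⟨s, hs⟩ := hN.out
  let ψ (x : N) := contract (M := M) (S := S) (Finsupp.lapply x ∘ₗ s)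
  let ψ' (x : N) := contract (M := M') (S := S) (Finsupp.lapply x ∘ₗ s)
  have hψ (x : N) (n : N) (m : M) : ψ x (mk S n m) = (s n x).unop • m := rfl
  have hnat (x : N) (y : BimodTensor S A N M) : ψ' x (map S N f y) = f (ψ x y) := by
    induction y using BimodTensor.induction with
    | zero => simp
    | mk n m => simp [ψ, ψ']
    | add y z hy hz => simp [hy, hz]
  -- Coordinates determine `y`. Allowing every larger finite set lets the sets of two summands be
  -- merged.
  have hrec (y : BimodTensor S A N M) : ∃ t : Finset N, ∀ t', t ⊆ t' →
      y = ∑ x ∈ t', mk S x (ψ x y) := by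
    classical
    induction y using BimodTensor.induction with
    | zero => exact ⟨∅, fun t _ => by simp [← mkHom_apply]⟩
    | mk n m =>
      refine ⟨(s n).support, fun t ht => ?_⟩
      have h1 : n = ∑ x ∈ t, s n x • x := by
        conv_lhs => rw [← hs n]
        rw [Finsupp.linearCombination_apply, Finsupp.sum_of_support_subset _ ht _ (by simp)]
        rfl
      calc mk S n m = mkHom S A N M (∑ x ∈ t, s n x • x) m := by rw [← h1]; rfl
        _ = ∑ x ∈ t, mk S (s n x • x) m := by simp
        _ = _ := Finset.sum_congr rfl fun x _ => by
          rw [hψ, ← mk_op_smul, MulOpposite.op_unop]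
    | add y z hy hz =>
      obtain ⟨t, ht⟩ := hy
      obtain ⟨t', ht'⟩ := hz
      refine ⟨t ∪ t', fun u hu => ?_⟩
      conv_lhs => rw [ht u (Finset.union_subset_left hu), ht' u (Finset.union_subset_right hu)]
      simp [← Finset.sum_add_distrib, mk_add_right]
  rw [injective_iff_map_eq_zero]
  intro y hy
  obtain ⟨t, ht⟩ := hrec y
  rw [ht t subset_rfl]
  refine Finset.sum_eq_zero fun x _ => ?_
  rw [(injective_iff_map_eq_zero f).mp hf (ψ x y) (by rw [← hnat, hy, map_zero]),
    ← mkHom_apply, map_zero]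

end BimodTensor

/-! ### The functor `G`: adjunction, splitting over `Λ`, exactness. -/

namespace SplitByNilpotentExt

variable {R : Type*} {Λ Γ : Type u} [CommRing R] [Ring Λ] [Ring Γ]
  [Algebra R Λ] [Algebra R Γ] {I : TwoSidedIdeal Γ} (E : SplitByNilpotentExt R Λ Γ I)

/-- The section as a ring homomorphism. -/
abbrev secHom : Λ →+* Γ := E.sec

/-- The projection as a ring homomorphism. -/
abbrev projHom : Γ →+* Λ := E.proj

/-- The restriction of a `Γ`-module to `Λ` along the section. -/
noncomputable abbrev res (Y : ModuleCat.{u} Γ) : ModuleCat.{u} Λ :=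
  (ModuleCat.restrictScalars E.secHom).obj Y

/-- The map `m ↦ 1 ⊗ m`. -/
noncomputable def unit (M : ModuleCat.{u} Λ) : M →ₛₗ[E.secHom] E.G M where
  toFun m := BimodTensor.mk (N := E.GammaBimod) Γ (1 : Γ) m
  map_add' m m' := BimodTensor.mk_add_right (N := E.GammaBimod) (1 : Γ) m m'
  map_smul' a m := by
    refine (BimodTensor.mk_op_smul (N := E.GammaBimod) a (1 : Γ) m).symm.trans ?_
    refine Eq.trans ?_ (BimodTensor.smul_mk (N := E.GammaBimod) (E.sec a) (1 : Γ) m).symm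
    congr 1
    change (1 : Γ) * E.sec a = E.sec a * 1
    rw [one_mul, mul_one]

variable {E} in
theorem mk_eq_smul_unit {M : ModuleCat.{u} Λ} (g : Γ) (m : M) :
    (BimodTensor.mk (N := E.GammaBimod) Γ g m : E.G M) = g • E.unit M m := by
  refine Eq.trans ?_ (BimodTensor.smul_mk (N := E.GammaBimod) g (1 : Γ) m).symm
  congr 1
  exact (mul_one g).symm

variable {E} in
@[elab_as_elim]
theorem G_induction {M : ModuleCat.{u} Λ} {motive : E.G M → Prop} (x : E.G M)
    (zero : motive 0) (smul_unit : ∀ (g : Γ) m, motive (g • E.unit M m))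
    (add : ∀ x y, motive x → motive y → motive (x + y)) : motive x :=
  BimodTensor.induction (motive := motive) x zero
    (fun g m => (mk_eq_smul_unit (E := E) g m).symm ▸ smul_unit g m) add

variable {E} in
/-- The adjunct of a map from `M` to a `Γ`-module. -/
noncomputable def liftG {M : ModuleCat.{u} Λ} {Y : Type*} [AddCommGroup Y] [Module Γ Y]
    (f : M →ₛₗ[E.secHom] Y) : E.G M →ₗ[Γ] Y :=
  BimodTensor.linearMapOfAddHom (ρ := RingHom.id Γ) (N := E.GammaBimod)
    (BimodTensor.lift (AddMonoidHom.mk' (fun n : E.GammaBimod => AddMonoidHom.mk'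
        (fun m => (show Γ from n) • f m) fun m m' => by rw [map_add, smul_add])
      fun n n' => by ext m; exact add_smul (show Γ from n) (show Γ from n') (f m))
      fun n a m => by
        change ((show Γ from n) * E.sec a) • f m = (show Γ from n) • f (a • m)
        rw [f.map_smulₛₗ, smul_smul]; rfl)
    fun s n m => mul_smul s (show Γ from n) (f m)

variable {E} in
@[simp]
theorem liftG_unit {M : ModuleCat.{u} Λ} {Y : Type*} [AddCommGroup Y] [Module Γ Y]
    (f : M →ₛₗ[E.secHom] Y) (m : M) : liftG f (E.unit M m) = f m :=
  one_smul Γ (f m)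

variable {E} in
theorem G_hom_ext {M : ModuleCat.{u} Λ} {Y : Type*} [AddCommGroup Y] [Module Γ Y]
    {f g : E.G M →ₗ[Γ] Y} (h : ∀ m, f (E.unit M m) = g (E.unit M m)) : f = g := by
  ext x
  induction x using G_induction with
  | zero => simp
  | smul_unit a m => simp [h]
  | add x y hx hy => simp [hx, hy]

/-- The functor `G` on maps. -/
noncomputable def mapG {M N : ModuleCat.{u} Λ} (f : M →ₗ[Λ] N) : E.G M →ₗ[Γ] E.G N :=
  liftG ((E.unit N).comp f)

@[simp]
theorem mapG_unit {M N : ModuleCat.{u} Λ} (f : M →ₗ[Λ] N) (m : M) :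
    E.mapG f (E.unit M m) = E.unit N (f m) := liftG_unit _ m

theorem mapG_comp {L M N : ModuleCat.{u} Λ} (f : M →ₗ[Λ] N) (g : L →ₗ[Λ] M) :
    E.mapG (f ∘ₗ g) = E.mapG f ∘ₗ E.mapG g := G_hom_ext fun m => by simp

/-- The map `γ ⊗ m ↦ π(γ) m`. -/
noncomputable def toBase (M : ModuleCat.{u} Λ) : E.G M →ₛₗ[E.projHom] M :=
  BimodTensor.linearMapOfAddHom (N := E.GammaBimod)
    (BimodTensor.lift (AddMonoidHom.mk' (fun n : E.GammaBimod => AddMonoidHom.mk'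
        (fun m => E.proj (show Γ from n) • m) fun m m' => smul_add _ m m')
      fun n n' => by
        ext m
        change E.proj ((show Γ from n) + (show Γ from n')) • m = _
        rw [map_add, add_smul]; rfl)
      fun n a m => by
        change E.proj ((show Γ from n) * E.sec a) • m = E.proj (show Γ from n) • a • m
        rw [map_mul, E.proj_sec, mul_smul])
    fun s n m => by
      change E.proj (s * (show Γ from n)) • m = E.proj s • E.proj (show Γ from n) • m
      rw [map_mul, mul_smul]

@[simp]
theorem toBase_unit {M : ModuleCat.{u} Λ} (m : M) : E.toBase M (E.unit M m) = m := by
  change E.proj 1 • m = m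
  rw [map_one, one_smul]

theorem toBase_mapG {M N : ModuleCat.{u} Λ} (f : M →ₗ[Λ] N) (x : E.G M) :
    E.toBase N (E.mapG f x) = f (E.toBase M x) := by
  induction x using G_induction with
  | zero => simp
  | smul_unit a m => simp
  | add x y hx hy => simp [hx, hy]

variable {E} in
/-- The element of `Γ` underlying an element of `I`. -/
def idealVal (n : E.IdealBimod) : Γ := (show I from n).1

theorem proj_idealVal (n : E.IdealBimod) : E.proj (idealVal n) = 0 :=
  (E.mem_iff _).mp (show I from n).2

variable {E} in
theorem idealVal_injective {n n' : E.IdealBimod} (h : idealVal n = idealVal n') : n = n' :=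
  Subtype.ext h

/-- The component in `I` of an element of `Γ`. -/
noncomputable def idealPart : Γ →+ E.IdealBimod :=
  AddMonoidHom.mk' (fun g => (⟨g - E.sec (E.proj g), by
    rw [E.mem_iff, map_sub, E.proj_sec, sub_self]⟩ : I)) fun g g' => Subtype.ext (by
      change g + g' - E.sec (E.proj (g + g')) =
        (g - E.sec (E.proj g)) + (g' - E.sec (E.proj g'))
      rw [map_add, map_add]; abel)

theorem idealVal_idealPart (g : Γ) : idealVal (E.idealPart g) = g - E.sec (E.proj g) := rfl

theorem idealPart_idealVal (n : E.IdealBimod) : E.idealPart (idealVal n) = n :=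
  idealVal_injective (by rw [idealVal_idealPart, proj_idealVal, map_zero, sub_zero])

theorem idealPart_mul_sec (g : Γ) (a : Λ) :
    E.idealPart (g * E.sec a) = MulOpposite.op a • E.idealPart g :=
  idealVal_injective (by
    change _ = (g - E.sec (E.proj g)) * E.sec a
    rw [idealVal_idealPart, map_mul, map_mul, E.proj_sec, sub_mul])

theorem idealPart_sec_mul (a : Λ) (g : Γ) : E.idealPart (E.sec a * g) = a • E.idealPart g :=
  idealVal_injective (by
    change _ = E.sec a * (g - E.sec (E.proj g))
    rw [idealVal_idealPart, map_mul, map_mul, E.proj_sec, mul_sub])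

/-- The element `n ⊗ m` of `I ⊗ M`. -/
noncomputable def idealTmul {M : ModuleCat.{u} Λ} (n : E.IdealBimod) (m : M) : E.idealTensor M :=
  BimodTensor.mk (N := E.IdealBimod) Λ n m

variable {E} in
@[elab_as_elim]
theorem idealTensor_induction {M : ModuleCat.{u} Λ} {motive : E.idealTensor M → Prop}
    (x : E.idealTensor M) (zero : motive 0) (tmul : ∀ n m, motive (E.idealTmul n m))
    (add : ∀ x y, motive x → motive y → motive (x + y)) : motive x :=
  BimodTensor.induction (motive := motive) x zero tmul add

/-- The map `I ⊗ f`. -/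
noncomputable def mapIdeal {M N : ModuleCat.{u} Λ} (f : M →ₗ[Λ] N) :
    E.idealTensor M →ₗ[Λ] E.idealTensor N :=
  BimodTensor.map Λ E.IdealBimod f

@[simp]
theorem mapIdeal_tmul {M N : ModuleCat.{u} Λ} (f : M →ₗ[Λ] N) (n : E.IdealBimod) (m : M) :
    E.mapIdeal f (E.idealTmul n m) = E.idealTmul n (f m) := rfl

/-- The map `γ ⊗ m ↦ (γ - σπ(γ)) ⊗ m`. -/
noncomputable def toIdeal (M : ModuleCat.{u} Λ) : E.G M →+ E.idealTensor M :=
  BimodTensor.lift (N := E.GammaBimod)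
    ((BimodTensor.mkHom Λ Λ E.IdealBimod M).comp E.idealPart) fun n a m =>
      (congrArg (BimodTensor.mk Λ · m) (E.idealPart_mul_sec n a)).trans
        (BimodTensor.mk_op_smul a _ m)

@[simp]
theorem toIdeal_smul_unit {M : ModuleCat.{u} Λ} (g : Γ) (m : M) :
    E.toIdeal M (g • E.unit M m) = E.idealTmul (E.idealPart g) m := by
  rw [← mk_eq_smul_unit]; rfl

theorem toIdeal_unit {M : ModuleCat.{u} Λ} (m : M) : E.toIdeal M (E.unit M m) = 0 := by
  rw [← one_smul Γ (E.unit M m), toIdeal_smul_unit]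
  have : E.idealPart 1 = 0 := idealVal_injective (by
    rw [idealVal_idealPart, map_one, map_one, sub_self]; rfl)
  rw [this]
  exact BimodTensor.mk_zero_left m

theorem toIdeal_sec_smul {M : ModuleCat.{u} Λ} (a : Λ) (x : E.G M) :
    E.toIdeal M (E.sec a • x) = a • E.toIdeal M x := by
  induction x using G_induction with
  | zero => simp
  | smul_unit g m =>
    rw [smul_smul, toIdeal_smul_unit, toIdeal_smul_unit, idealPart_sec_mul]; rfl
  | add x y hx hy => rw [smul_add, map_add, hx, hy, map_add, smul_add]

theorem toIdeal_mapG {M N : ModuleCat.{u} Λ} (f : M →ₗ[Λ] N) (x : E.G M) :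
    E.toIdeal N (E.mapG f x) = E.mapIdeal f (E.toIdeal M x) := by
  induction x using G_induction with
  | zero => simp
  | smul_unit a m => simp
  | add x y hx hy => simp [hx, hy]

/-- The map `i ⊗ m ↦ i ⊗ m` from `I ⊗ M` to `Γ ⊗ M`. -/
noncomputable def ofIdeal (M : ModuleCat.{u} Λ) : E.idealTensor M →+ E.G M :=
  BimodTensor.lift (N := E.IdealBimod) (T := E.G M)
    (AddMonoidHom.mk' (fun n => AddMonoidHom.mk'
        (fun m => idealVal n • E.unit M m) fun m m' => by rw [map_add, smul_add])
      fun n n' => by ext m; exact add_smul (idealVal n) (idealVal n') (E.unit M m))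
    fun n a m => by
      change (idealVal n * E.sec a) • E.unit M m = idealVal n • E.unit M (a • m)
      rw [(E.unit M).map_smulₛₗ, smul_smul]; rfl

@[simp]
theorem ofIdeal_tmul {M : ModuleCat.{u} Λ} (n : E.IdealBimod) (m : M) :
    E.ofIdeal M (E.idealTmul n m) = idealVal n • E.unit M m := rfl

/-- This is `γ = σπ(γ) + (γ - σπ(γ))`, tensored with `M`. -/
theorem unit_toBase_add_ofIdeal_toIdeal {M : ModuleCat.{u} Λ} (x : E.G M) :
    E.unit M (E.toBase M x) + E.ofIdeal M (E.toIdeal M x) = x := by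
  induction x using G_induction with
  | zero => simp
  | smul_unit g m =>
    rw [toIdeal_smul_unit, ofIdeal_tmul, (E.toBase M).map_smulₛₗ, toBase_unit,
      (E.unit M).map_smulₛₗ, ← add_smul]
    congr 1
    exact add_sub_cancel _ _
  | add x y hx hy =>
    conv_rhs => rw [← hx, ← hy]
    simp only [map_add]
    abel

theorem toBase_ofIdeal {M : ModuleCat.{u} Λ} (y : E.idealTensor M) :
    E.toBase M (E.ofIdeal M y) = 0 := by
  induction y using idealTensor_induction with
  | zero => simp
  | tmul n m =>
    rw [ofIdeal_tmul, (E.toBase M).map_smulₛₗ]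
    exact (congrArg (· • E.toBase M (E.unit M m)) (E.proj_idealVal n)).trans (zero_smul _ _)
  | add x y hx hy => rw [map_add, map_add, hx, hy, add_zero]

theorem toIdeal_ofIdeal {M : ModuleCat.{u} Λ} (y : E.idealTensor M) :
    E.toIdeal M (E.ofIdeal M y) = y := by
  induction y using idealTensor_induction with
  | zero => simp
  | tmul n m => rw [ofIdeal_tmul, toIdeal_smul_unit, idealPart_idealVal]
  | add x y hx hy => rw [map_add, map_add, hx, hy]

/-- `Γ ⊗ M` is, as a `Λ`-module, the direct sum of `M` and `I ⊗ M`. -/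
noncomputable def resGEquiv (M : ModuleCat.{u} Λ) :
    E.res (E.G M) ≃ₗ[Λ] (M × E.idealTensor M) where
  toFun x := (E.toBase M (x : E.G M), E.toIdeal M (x : E.G M))
  map_add' x y := Prod.ext (map_add (E.toBase M) (x : E.G M) y)
    (map_add (E.toIdeal M) (x : E.G M) y)
  map_smul' a x := Prod.ext (((E.toBase M).map_smulₛₗ (E.sec a) (x : E.G M)).trans
    (congrArg (· • E.toBase M (x : E.G M)) (E.proj_sec a))) (E.toIdeal_sec_smul a x)
  invFun z := (E.unit M z.1 + E.ofIdeal M z.2 : E.G M)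
  left_inv x := E.unit_toBase_add_ofIdeal_toIdeal (M := M) x
  right_inv z := Prod.ext
    ((map_add (E.toBase M) _ _).trans (by rw [toBase_unit, toBase_ofIdeal, add_zero]))
    ((map_add (E.toIdeal M) _ _).trans (by rw [toIdeal_ofIdeal, toIdeal_unit, zero_add]))

theorem mapG_surjective {M N : ModuleCat.{u} Λ} {f : M →ₗ[Λ] N} (hf : Function.Surjective f) :
    Function.Surjective (E.mapG f) := by
  intro x
  induction x using G_induction with
  | zero => exact ⟨0, map_zero _⟩
  | smul_unit g n =>
    obtain ⟨m, rfl⟩ := hf n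
    exact ⟨g • E.unit M m, by simp⟩
  | add x y hx hy =>
    obtain ⟨x, rfl⟩ := hx
    obtain ⟨y, rfl⟩ := hy
    exact ⟨x + y, map_add _ _ _⟩

/-- Right exactness comes from the adjunction: the quotient of `G M` by the range of `G i` receives
a map from `G N` through which the quotient map factors. -/
theorem mapG_exact {K M N : ModuleCat.{u} Λ} {i : K →ₗ[Λ] M} {p : M →ₗ[Λ] N}
    (h : Function.Exact i p) (hp : Function.Surjective p) :
    Function.Exact (E.mapG i) (E.mapG p) := by
  have hpi : p ∘ₗ i = 0 := h.linearMap_comp_eq_zero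
  rw [LinearMap.exact_iff]
  refine le_antisymm ?_ ?_
  · let L := LinearMap.range (E.mapG i)
    have hw (m : M) (hm : p m = 0) : L.mkQ (E.unit M m) = 0 := by
      obtain ⟨k, rfl⟩ := (h m).mp hm
      rw [Submodule.mkQ_apply, Submodule.Quotient.mk_eq_zero]
      exact ⟨E.unit K k, E.mapG_unit i k⟩
    have hsub (m m' : M) (hm : p m = p m') : L.mkQ (E.unit M m) = L.mkQ (E.unit M m') := by
      rw [← sub_eq_zero, ← map_sub, ← map_sub]
      exact hw _ (by rw [map_sub, hm, sub_self])
    -- The section is only set-theoretic; modulo `L` the choice of preimage does not matter.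
    let s := Function.surjInv hp
    have hs : ∀ n, p (s n) = n := Function.surjInv_eq hp
    let f : N →ₛₗ[E.secHom] (E.G M ⧸ L) :=
      { toFun := fun n => L.mkQ (E.unit M (s n))
        map_add' := fun n n' => by
          rw [← map_add, ← map_add]; exact hsub _ _ (by simp [hs])
        map_smul' := fun a n => by
          rw [← map_smul, ← (E.unit M).map_smulₛₗ]; exact hsub _ _ (by simp [hs]) }
    have hf : liftG f ∘ₗ E.mapG p = L.mkQ := G_hom_ext fun m => by
      rw [LinearMap.comp_apply, mapG_unit, liftG_unit]
      exact hsub _ _ (hs _)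
    intro x hx
    change x ∈ L
    rw [← L.ker_mkQ, ← hf, LinearMap.mem_ker, LinearMap.comp_apply, LinearMap.mem_ker.mp hx,
      map_zero]
  · rw [LinearMap.range_le_ker_iff, ← mapG_comp, hpi]
    exact G_hom_ext fun m => by simp

/-- Under the splitting `G f` becomes `f × (I ⊗ f)`; projectivity of `I` serves the second factor.
-/
theorem mapG_injective (hI : Module.Projective Λᵐᵒᵖ E.IdealBimod) {M N : ModuleCat.{u} Λ}
    {f : M →ₗ[Λ] N} (hf : Function.Injective f) : Function.Injective (E.mapG f) := by
  rw [injective_iff_map_eq_zero]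
  intro x hx
  have h1 : E.toBase M x = 0 := hf (by rw [← toBase_mapG, hx, map_zero, map_zero])
  have h2 : E.toIdeal M x = 0 := by
    have hi : Function.Injective (E.mapIdeal f) :=
      BimodTensor.map_injective (S := Λ) (N := E.IdealBimod) f hf
    exact hi (by rw [← toIdeal_mapG, hx, map_zero, map_zero])
  rw [← E.unit_toBase_add_ofIdeal_toIdeal x, h1, h2, map_zero, map_zero, add_zero]

end SplitByNilpotentExt

/-! ### Transfer of Ext, Hom, indecomposability, filtrations and sums along `G`. -/

namespace SplitByNilpotentExt

variable {R : Type*} {Λ Γ : Type u} [CommRing R] [Ring Λ] [Ring Γ]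
  [Algebra R Λ] [Algebra R Γ] {I : TwoSidedIdeal Γ} (E : SplitByNilpotentExt R Λ Γ I)

variable {E} in
/-- A map into a restricted module as a semilinear map. -/
noncomputable def ofRes {M : ModuleCat.{u} Λ} {Y : ModuleCat.{u} Γ} (f : M →ₗ[Λ] E.res Y) :
    M →ₛₗ[E.secHom] Y where
  toFun m := f m
  map_add' := map_add f
  map_smul' := map_smul f

variable {E} in
/-- A semilinear map as a map into a restricted module. -/
noncomputable def toRes {M : ModuleCat.{u} Λ} {Y : ModuleCat.{u} Γ} (f : M →ₛₗ[E.secHom] Y) :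
    M →ₗ[Λ] E.res Y where
  toFun m := f m
  map_add' := map_add f
  map_smul' := f.map_smulₛₗ

/-- A left adjoint of a functor preserving surjections preserves projectives: it suffices to split
the free cover of `G P`, and the splitting is the adjunct of a lift of the unit. -/
theorem projective_G (P : ModuleCat.{u} Λ) [Module.Projective Λ P] :
    Module.Projective Γ (E.G P) := by
  refine Module.Projective.of_lifting_property'' fun f hf => ?_
  let X := ModuleCat.of Γ (E.G P →₀ Γ)
  let f' : E.res X →ₗ[Λ] E.res (E.G P) :=
    { toFun := fun x => f x
      map_add' := map_add f
      map_smul' := fun a x => map_smul f (E.sec a) x }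
  obtain ⟨g, hg⟩ := Module.projective_lifting_property f' (toRes (E.unit P)) hf
  refine ⟨liftG (ofRes (Y := X) g), G_hom_ext fun m => ?_⟩
  rw [LinearMap.comp_apply, liftG_unit]
  exact LinearMap.congr_fun hg m

/-- `G` turns a projective presentation of `M` into one of `G M`, and the adjunction matches the two
extension problems. -/
theorem extOneVanishes_G_iff (hI : Module.Projective Λᵐᵒᵖ E.IdealBimod)
    {M : ModuleCat.{u} Λ} {Y : ModuleCat.{u} Γ} :
    ExtOneVanishes (E.G M) Y ↔ ExtOneVanishes M (E.res Y) := by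
  obtain ⟨K, P, i, p, hP, hi, hip, hp⟩ := exists_projective_presentation (A := Λ) M
  have := E.projective_G P
  rw [extOneVanishes_iff_of_projective i p hi hip hp,
    extOneVanishes_iff_of_projective (E.mapG i) (E.mapG p) (E.mapG_injective hI hi)
      (E.mapG_exact hip hp) (E.mapG_surjective hp)]
  constructor
  · intro h f
    obtain ⟨g, hg⟩ := h (liftG (ofRes f))
    refine ⟨toRes (g.comp (E.unit P)), LinearMap.ext fun k => ?_⟩
    have := LinearMap.congr_fun hg (E.unit K k)
    rwa [LinearMap.comp_apply, mapG_unit, liftG_unit] at this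
  · intro h f
    obtain ⟨g, hg⟩ := h (toRes (f.comp (E.unit K)))
    refine ⟨liftG (ofRes g), G_hom_ext fun k => ?_⟩
    rw [LinearMap.comp_apply, mapG_unit, liftG_unit]
    exact LinearMap.congr_fun hg k

theorem extOneVanishes_G_G_iff (hI : Module.Projective Λᵐᵒᵖ E.IdealBimod)
    {M N : ModuleCat.{u} Λ} :
    ExtOneVanishes (E.G M) (E.G N) ↔ ExtOneVanishes M N ∧ ExtOneVanishes M (E.idealTensor N) := by
  rw [extOneVanishes_G_iff E hI, ← extOneVanishes_prod_iff]
  exact extOneVanishes_congr_right (Y' := ModuleCat.of Λ (N × E.idealTensor N)) (E.resGEquiv N)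

theorem G_hom_eq_zero {M N : ModuleCat.{u} Λ} (h : ∀ f : M →ₗ[Λ] N, f = 0)
    (h' : ∀ f : M →ₗ[Λ] E.idealTensor N, f = 0) (f : E.G M →ₗ[Γ] E.G N) : f = 0 := by
  refine G_hom_ext fun m => ?_
  let g : M →ₗ[Λ] (N × E.idealTensor N) :=
    (E.resGEquiv N).toLinearMap ∘ₗ toRes (f.comp (E.unit M))
  have hg : g m = 0 := Prod.ext (LinearMap.congr_fun (h (LinearMap.fst Λ _ _ ∘ₗ g)) m)
    (LinearMap.congr_fun (h' (LinearMap.snd Λ _ _ ∘ₗ g)) m)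
  exact (E.resGEquiv N).map_eq_zero_iff.mp hg

theorem finite_G (M : ModuleCat.{u} Λ) [Module.Finite Λ M] : Module.Finite Γ (E.G M) := by
  obtain ⟨s, hs⟩ := Module.Finite.fg_top (R := Λ) (M := M)
  classical
  refine ⟨s.image (E.unit M), ?_⟩
  have h (m : M) : E.unit M m ∈ Submodule.span Γ (s.image (E.unit M) : Set (E.G M)) := by
    have hm : m ∈ Submodule.span Λ (s : Set M) := hs ▸ Submodule.mem_top
    induction hm using Submodule.span_induction with
    | mem m hm => exact Submodule.subset_span (by simpa using ⟨m, hm, rfl⟩)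
    | zero => simp
    | add x y _ _ hx hy => rw [map_add]; exact add_mem hx hy
    | smul a x _ hx => rw [(E.unit M).map_smulₛₗ]; exact Submodule.smul_mem _ _ hx
  refine eq_top_iff.mpr fun x _ => ?_
  induction x using G_induction with
  | zero => exact zero_mem _
  | smul_unit g m => exact Submodule.smul_mem _ _ (h m)
  | add x y hx hy => exact add_mem (hx trivial) (hy trivial)

theorem nontrivial_G (M : ModuleCat.{u} Λ) [Nontrivial M] : Nontrivial (E.G M) :=
  Function.Surjective.nontrivial (f := E.toBase M) fun m => ⟨E.unit M m, E.toBase_unit m⟩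

/-- The kernel of `toBase` is the image of `I ⊗ M`, and `I` lies in the radical. -/
theorem mem_jacobson_smul_top {M : ModuleCat.{u} Λ} {x : E.G M} (hx : E.toBase M x = 0) :
    x ∈ Ring.jacobson Γ • (⊤ : Submodule Γ (E.G M)) := by
  rw [← E.unit_toBase_add_ofIdeal_toIdeal x, hx, map_zero, zero_add]
  induction E.toIdeal M x using idealTensor_induction with
  | zero => simp
  | tmul n m =>
    rw [ofIdeal_tmul]
    exact Submodule.smul_mem_smul (E.mem_jacobson _ (show I from n).2) Submodule.mem_top
  | add x y hx hy => rw [map_add]; exact add_mem hx hy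

/-- The endomorphism of `M` induced by an endomorphism of `Γ ⊗ M`. -/
noncomputable def baseEnd {M : ModuleCat.{u} Λ} (e : E.G M →ₗ[Γ] E.G M) : M →ₗ[Λ] M where
  toFun m := E.toBase M (e (E.unit M m))
  map_add' m m' := by simp
  map_smul' a m := by
    rw [(E.unit M).map_smulₛₗ, map_smul, (E.toBase M).map_smulₛₗ]
    exact congrArg (· • E.toBase M (e (E.unit M m))) (E.proj_sec a)

theorem baseEnd_toBase {M : ModuleCat.{u} Λ} (e : E.G M →ₗ[Γ] E.G M) (x : E.G M) :
    E.baseEnd e (E.toBase M x) = E.toBase M (e x) := by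
  induction x using G_induction with
  | zero => simp
  | smul_unit g m =>
    rw [(E.toBase M).map_smulₛₗ, toBase_unit, map_smul, map_smul, (E.toBase M).map_smulₛₗ]; rfl
  | add x y hx hy => simp [hx, hy]

/-- Nakayama applied to the range of `e`: writing `e x = e (e x)` with `e x` in `rad(Γ) · G M` puts
the range inside `rad(Γ)` times itself. -/
theorem eq_zero_of_baseEnd_eq_zero {M : ModuleCat.{u} Λ} [Module.Finite Λ M]
    {e : E.G M →ₗ[Γ] E.G M} (he : e ∘ₗ e = e) (h : E.baseEnd e = 0) : e = 0 := by
  have := E.finite_G M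
  rw [← LinearMap.range_eq_bot]
  refine Submodule.FG.eq_bot_of_le_jacobson_smul (LinearMap.range_eq_map e ▸
    (Module.Finite.fg_top (R := Γ) (M := E.G M)).map e) ?_
  rintro _ ⟨x, rfl⟩
  have hx : e x ∈ Ring.jacobson Γ • (⊤ : Submodule Γ (E.G M)) :=
    E.mem_jacobson_smul_top (by rw [← baseEnd_toBase, h, LinearMap.zero_apply])
  rw [LinearMap.range_eq_map, ← Submodule.map_smul'']
  exact ⟨e x, hx, LinearMap.congr_fun he x⟩

theorem indecomposable_G {M : ModuleCat.{u} Λ} [Module.Finite Λ M] (hM : Indecomposable M) :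
    Indecomposable (E.G M) := by
  rw [indecomposable_iff_idempotents] at hM ⊢
  obtain ⟨hM, h⟩ := hM
  refine ⟨E.nontrivial_G M, fun e he => ?_⟩
  rcases h (E.baseEnd e) (LinearMap.ext fun m => (E.baseEnd_toBase e _).trans
    (congrArg (E.toBase M) (LinearMap.congr_fun he _))) with h | h
  · exact Or.inl (E.eq_zero_of_baseEnd_eq_zero he h)
  -- If `e` reduces to the identity, the complementary idempotent reduces to zero.
  · refine Or.inr (sub_eq_zero.mp (E.eq_zero_of_baseEnd_eq_zero
      (e := LinearMap.id - e) ?_ (LinearMap.ext fun m => ?_))).symm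
    · rw [LinearMap.comp_sub, LinearMap.sub_comp, LinearMap.sub_comp, he]; simp
    · have hm : E.toBase M (e (E.unit M m)) = m := LinearMap.congr_fun h m
      change E.toBase M (E.unit M m - e (E.unit M m)) = 0
      rw [map_sub, hm, toBase_unit, sub_self]

/-- By exactness the images of the `G (F k)` form a chain whose factors are `G` of the old factors.
-/
theorem isFilteredBy_G (hI : Module.Projective Λᵐᵒᵖ E.IdealBimod) {C : Set (ModuleCat.{u} Λ)}
    {M : ModuleCat.{u} Λ} (h : IsFilteredBy C M) : IsFilteredBy (E.G '' C) (E.G M) := by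
  obtain ⟨s, F, h0, hs, hF⟩ := h
  let j (k : ℕ) : E.G (ModuleCat.of Λ (F k)) →ₗ[Γ] E.G M := E.mapG (F k).subtype
  have hj (k : ℕ) : Function.Injective (j k) := E.mapG_injective hI (F k).injective_subtype
  refine ⟨s, fun k => LinearMap.range (j k), ?_, ?_, fun k hk => ?_⟩
  · rw [LinearMap.range_eq_bot]
    refine G_hom_ext fun m => ?_
    have : (F 0).subtype m = 0 := by simpa [h0] using m.2
    exact (E.mapG_unit (M := ModuleCat.of Λ (F 0)) (F 0).subtype m).trans <| (congrArg (E.unit M) this).trans (map_zero _)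
  · refine LinearMap.range_eq_top.mpr (E.mapG_surjective fun m => ⟨⟨m, ?_⟩, rfl⟩)
    rw [hs]; trivial
  · obtain ⟨hle, X, hX, ⟨e⟩⟩ := hF k hk
    let a : ModuleCat.of Λ (F k) →ₗ[Λ] ModuleCat.of Λ (F (k + 1)) := Submodule.inclusion hle
    let b : ModuleCat.of Λ (F (k + 1)) →ₗ[Λ] X := e.toLinearMap ∘ₗ Submodule.mkQ _
    have hb : Function.Surjective b := e.surjective.comp (Submodule.mkQ_surjective _)
    have hab : Function.Exact a b := fun y => by
      simp only [b, LinearMap.comp_apply, LinearEquiv.coe_coe, e.map_eq_zero_iff,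
        Submodule.mkQ_apply, Submodule.Quotient.mk_eq_zero]
      exact ⟨fun hy => ⟨⟨y.1, hy⟩, rfl⟩, fun ⟨z, hz⟩ => hz ▸ z.2⟩
    have hcomp : j k = j (k + 1) ∘ₗ E.mapG a := by
      rw [← mapG_comp]; rfl
    have hle' : LinearMap.range (j k) ≤ LinearMap.range (j (k + 1)) := by
      rw [hcomp]; exact LinearMap.range_comp_le_range _ _
    refine ⟨hle', E.G X, ⟨X, hX, rfl⟩, ⟨?_⟩⟩
    let φ := LinearEquiv.ofInjective (j (k + 1)) (hj (k + 1))
    let ψ : LinearMap.range (j (k + 1)) →ₗ[Γ] E.G X := E.mapG b ∘ₗ φ.symm.toLinearMap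
    have hψ : Function.Surjective ψ := (E.mapG_surjective hb).comp φ.symm.surjective
    have hker : (LinearMap.range (j k)).submoduleOf (LinearMap.range (j (k + 1))) =
        LinearMap.ker ψ := by
      ext y
      obtain ⟨x, rfl⟩ := φ.surjective y
      rw [LinearMap.mem_ker, LinearMap.comp_apply, LinearEquiv.coe_coe, φ.symm_apply_apply,
        E.mapG_exact hab hb x, hcomp]
      exact ⟨fun ⟨z, hz⟩ => ⟨z, hj _ hz⟩, fun ⟨z, hz⟩ => ⟨z, congrArg (j (k + 1)) hz⟩⟩
    exact (Submodule.quotEquivOfEq _ _ hker).trans (ψ.quotKerEquivOfSurjective hψ)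

/-- `G` commutes with direct sums. -/
theorem nonempty_G_sumModule_equiv {ι : Type} [DecidableEq ι] (X : ι → ModuleCat.{u} Λ) :
    Nonempty (E.G (sumModule X) ≃ₗ[Γ] sumModule fun i => E.G (X i)) := by
  let f : sumModule X →ₛₗ[E.secHom] sumModule fun i => E.G (X i) :=
    { toFun := DirectSum.map fun i => (E.unit (X i)).toAddMonoidHom
      map_add' := map_add _
      map_smul' := fun a x => by
        refine DFinsupp.ext fun i => ?_
        exact (E.unit (X i)).map_smulₛₗ a (x i) }
  have hf (i : ι) (m : X i) : f (DirectSum.lof Λ ι _ i m) = DirectSum.lof Γ ι _ i (E.unit _ m) :=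
    DirectSum.map_of (fun i => (E.unit (X i)).toAddMonoidHom) i m
  let g : (sumModule fun i => E.G (X i)) →ₗ[Γ] E.G (sumModule X) :=
    DirectSum.toModule Γ ι _ fun i => E.mapG (N := sumModule X) (DirectSum.lof Λ ι (fun i => X i) i)
  have hg (i : ι) (x : E.G (X i)) : g (DirectSum.lof Γ ι _ i x) =
      E.mapG (N := sumModule X) (DirectSum.lof Λ ι (fun i => X i) i) x :=
    DirectSum.toModule_lof Γ (M := fun i => E.G (X i)) (N := E.G (sumModule X))
      (φ := fun i => E.mapG (N := sumModule X) (DirectSum.lof Λ ι (fun i => X i) i)) i x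
  refine ⟨LinearEquiv.ofLinearMap (liftG f) g ?_ ?_⟩
  · refine DirectSum.linearMap_ext Γ fun i => G_hom_ext fun m => ?_
    simp only [LinearMap.comp_apply]
    rw [hg, mapG_unit, liftG_unit, hf]; rfl
  · refine G_hom_ext fun x => ?_
    -- Additive maps out of a direct sum may be compared on the summands.
    have : (g.comp f : sumModule X →ₛₗ[E.secHom] _) = E.unit (sumModule X) := by
      apply LinearMap.toAddMonoidHom_injective
      refine DirectSum.addHom_ext fun i m => ?_
      change g (f (DirectSum.lof Λ ι _ i m)) = E.unit (sumModule X) (DirectSum.lof Λ ι _ i m)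
      rw [hf, hg, mapG_unit]
    rw [LinearMap.comp_apply, liftG_unit]
    exact LinearMap.congr_fun this x

end SplitByNilpotentExt

theorem mainTheorem8 {R : Type*} [CommRing R] [IsArtinianRing R]
    {Λ Γ : Type u} [Ring Λ] [Ring Γ] [Algebra R Λ] [Algebra R Γ]
    [Module.Finite R Λ] [Module.Finite R Γ]
    {I : TwoSidedIdeal Γ} (E : SplitByNilpotentExt R Λ Γ I)
    (hI : Module.Projective Λᵐᵒᵖ E.IdealBimod)
    {ι : Type} [Fintype ι] [LinearOrder ι]
    (Θ Q : ι → ModuleCat.{u} Λ)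
    (hΘ : IsStratifyingSystem Θ) (hcomp : E.Compatible Θ)
    (hQ : IsAssociatedExtProj Θ Q) :
    IsStratifyingSystem (fun i => E.G (Θ i)) ∧
      (ExtOneVanishes (sumModule Q) (E.idealTensor (sumModule Θ)) ↔
        IsAssociatedExtProj (fun i => E.G (Θ i)) (fun i => E.G (Q i))) := by
  have hG : IsStratifyingSystem (fun i => E.G (Θ i)) :=
    { finite := fun i => have := hΘ.finite i; E.finite_G (Θ i)
      indecomposable := fun i => have := hΘ.finite i; E.indecomposable_G (hΘ.indecomposable i)
      hom_eq_zero := fun i j hij =>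
        E.G_hom_eq_zero (hΘ.hom_eq_zero i j hij) (hcomp.hom_eq_zero j i hij)
      ext_eq_zero := fun i j hij => (E.extOneVanishes_G_G_iff hI).mpr
        ⟨hΘ.ext_eq_zero i j hij, hcomp.ext_eq_zero j i hij⟩ }
  -- After the sums are moved through `G`, the criterion yields two conditions, one of which belongs
  -- to `hQ`.
  have hext : ExtOneVanishes (sumModule fun i => E.G (Q i)) (sumModule fun i => E.G (Θ i)) ↔
      ExtOneVanishes (sumModule Q) (E.idealTensor (sumModule Θ)) := by
    obtain ⟨e⟩ := E.nonempty_G_sumModule_equiv Q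
    obtain ⟨e'⟩ := E.nonempty_G_sumModule_equiv Θ
    rw [← extOneVanishes_congr_left e, ← extOneVanishes_congr_right e',
      E.extOneVanishes_G_G_iff hI, and_iff_right hQ.2.ext_eq_zero]
  refine ⟨hG, fun h => ⟨hG, ?_⟩, fun h => hext.mp h.2.ext_eq_zero⟩
  exact
    { finite_left := hG.finite
      finite_right := fun i => have := hQ.2.finite_right i; E.finite_G (Q i)
      nontrivial_left := fun i => have := hQ.2.nontrivial_left i; E.nontrivial_G (Θ i)
      indecomposable := fun i =>
        have := hQ.2.finite_right i; E.indecomposable_G (hQ.2.indecomposable i)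
      hom_eq_zero := hG.hom_eq_zero
      exact_seq := fun i => by
        obtain ⟨K, α, β, hα, hαβ, hβ, hK⟩ := hQ.2.exact_seq i
        refine ⟨E.G K, E.mapG α, E.mapG β, E.mapG_injective hI hα, E.mapG_exact hαβ hβ,
          E.mapG_surjective hβ, ?_⟩
        convert E.isFilteredBy_G hI hK using 1
        ext X
        constructor
        · rintro ⟨j, hj, rfl⟩
          exact ⟨_, ⟨j, hj, rfl⟩, rfl⟩
        · rintro ⟨_, ⟨j, hj, rfl⟩, rfl⟩
          exact ⟨j, hj, rfl⟩
      ext_eq_zero := hext.mpr h }
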